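/- Let $G$ be a finite nilpotent group and let $\chi\in\mathrm{Irr}(G)$ be an irreducible complex character of $G$. Let $\omega(\chi)$ denote the number of primes $p$ dividing $\chi(1)$. Then \[ \frac{|\{g\in G : \chi(g)=0\}|}{|G|} \;\geq\; 1-\frac{1}{2^{\omega(\chi)}}\left(\frac{|G|-\chi(1)^2+2^{\omega(\chi)}}{|G|}\right). \] -/

import Mathlib

/-- `Irr G` is the set of irreducible complex characters of `G`: the functions `g ↦ tr ρ(g)` for `ρ` an
irreducible representation of `G` on a finite-dimensional complex vector space. Up to isomorphism,
which does not change the character, the space is `ℂⁿ`; the zero space is not irreducible. -/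
def Irr (G : Type*) [Group G] : Set (G → ℂ) :=
  {χ | ∃ (n : ℕ) (ρ : Representation ℂ G (Fin n → ℂ)), ρ.IsIrreducible ∧ ρ.character = χ}

/-- The value of an irreducible character at the identity is a positive integer. -/
theorem Irr.exists_degree {G : Type*} [Group G] {χ : G → ℂ} (hχ : χ ∈ Irr G) :
    ∃ d : ℕ, 0 < d ∧ χ 1 = (d : ℂ) := by
  obtain ⟨n, ρ, hρ, rfl⟩ := hχ
  refine ⟨n, Nat.pos_of_ne_zero ?_, by simp⟩
  rintro rfl
  obtain ⟨a, b, hab⟩ := hρ.toNontrivial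
  apply hab
  ext x
  rw [Subsingleton.elim x 0]
  exact ⟨fun _ => b.toSubmodule.zero_mem, fun _ => a.toSubmodule.zero_mem⟩

/-- The number of primes `p` that divide the degree `χ(1)` in the integers. -/
noncomputable def charOmega {G : Type*} [Group G] (χ : G → ℂ) : ℕ :=
  {p : ℕ | p.Prime ∧ ∃ d : ℕ, χ 1 = (d : ℂ) ∧ p ∣ d}.ncard

/-! With N the number of elements where χ does not vanish, the claim is 2^ω (N - 1) ≤ |G| - χ(1)²,
and by orthogonality the right side is the sum of |χ(g)|² over g ≠ 1.

For a p-group with p ∣ χ(1), this says that the nonzero values at g ≠ 1 have mean square at least 2.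
The maps g ↦ g^u with u prime to p permute the nonidentity elements, so it suffices to bound the
mean over u of |χ(g^u)|² for each g with χ(g) ≠ 0. Write χ(g) = ∑ m_x ζ^x with eigenvalue
multiplicities m_x; their sum χ(1) is divisible by p. Parseval turns the mean into a sum of scaled
variances of integer vectors of length p (`sum_norm_sq_fourier_not_dvd`), and integrality together
with this divisibility makes the sum at least 2(p - 1) unless it is zero
(`two_mul_sub_one_le_sum_scaledVariance`).

A nilpotent group is the product of its Sylow subgroups, and its irreducible characters are products
of irreducible characters of the factors. Inequalities α(N - 1) ≤ A - a multiply when α ≤ a: factors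
of nontrivial degree supply α = 2, the others α = 1. -/

/-! ### Parseval's identity -/

open Finset in
/-- Parseval's identity for the discrete Fourier transform of an integer vector. -/
theorem IsPrimitiveRoot.sum_norm_sq_fourier {n : ℕ} {ζ : ℂ} (hζ : IsPrimitiveRoot ζ n)
    (hn : n ≠ 0) (c : Fin n → ℤ) :
    ∑ u ∈ range n, ‖∑ x, (c x : ℂ) * ζ ^ (u * (x : ℕ))‖ ^ 2 = n * ∑ x, (c x : ℝ) ^ 2 := by
  have hζ0 : ζ ≠ 0 := hζ.ne_zero hn
  have hconj : (starRingEnd ℂ) ζ = ζ⁻¹ :=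
    (Complex.inv_eq_conj (Complex.norm_eq_one_of_pow_eq_one hζ.pow_eq_one hn)).symm
  have geom (x y : Fin n) :
      ∑ u ∈ range n, (ζ ^ (x : ℕ) * (ζ ^ (y : ℕ))⁻¹) ^ u = if x = y then (n : ℂ) else 0 := by
    split_ifs with h
    · subst h
      simp [hζ0]
    · have h1 : ζ ^ (x : ℕ) * (ζ ^ (y : ℕ))⁻¹ ≠ 1 := by
        intro h1
        apply h
        apply Fin.ext
        apply hζ.pow_inj x.2 y.2
        field_simp at h1
        exact h1
      rw [geom_sum_eq h1, mul_pow, inv_pow, pow_right_comm, pow_right_comm ζ y, hζ.pow_eq_one]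
      simp
  have key : ∑ u ∈ range n, ((‖∑ x, (c x : ℂ) * ζ ^ (u * (x : ℕ))‖ : ℂ)) ^ 2 =
      n * ∑ x, (c x : ℂ) ^ 2 := by
    calc _ = ∑ u ∈ range n, ∑ x, ∑ y, (c x : ℂ) * c y * (ζ ^ (x : ℕ) * (ζ ^ (y : ℕ))⁻¹) ^ u := by
          refine sum_congr rfl fun u _ => ?_
          rw [← Complex.mul_conj', map_sum, sum_mul_sum]
          refine sum_congr rfl fun x _ => sum_congr rfl fun y _ => ?_
          rw [map_mul, map_pow, hconj, map_intCast, mul_pow, inv_pow, inv_pow, ← pow_mul,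
            ← pow_mul, mul_comm u, mul_comm u]
          ring
      _ = ∑ x, ∑ y, (c x : ℂ) * c y * ∑ u ∈ range n, (ζ ^ (x : ℕ) * (ζ ^ (y : ℕ))⁻¹) ^ u := by
          rw [sum_comm]
          refine sum_congr rfl fun x _ => ?_
          rw [sum_comm]
          simp_rw [mul_sum]
      _ = n * ∑ x, (c x : ℂ) ^ 2 := by
          simp_rw [geom]
          simp only [mul_ite, mul_zero, sum_ite_eq, mem_univ, if_true, mul_sum]
          refine sum_congr rfl fun x _ => ?_
          ring
  exact_mod_cast key

/-! ### Variances of integer vectors -/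

/-- `p²` times the variance of an integer vector of length `p`. -/
def Finset.scaledVariance {p : ℕ} (c : Fin p → ℤ) : ℤ := p * ∑ i, c i ^ 2 - (∑ i, c i) ^ 2

namespace Finset

theorem scaledVariance_sub_const {p : ℕ} (c : Fin p → ℤ) (t : ℤ) :
    scaledVariance (fun i => c i - t) = scaledVariance c := by
  unfold scaledVariance
  simp only [sub_sq, sum_sub_distrib, sum_add_distrib, ← mul_sum, ← sum_mul, sum_const, card_univ,
    Fintype.card_fin, nsmul_eq_mul]
  ring

/-- Subtracting the integer mean makes the entries sum to zero. As b² ≡ b mod 2, the sum of squares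
is then even, so it is at least 2 if nonzero. -/
theorem two_mul_le_scaledVariance {p : ℕ} (c : Fin p → ℤ) (h : (p : ℤ) ∣ ∑ i, c i)
    (h0 : scaledVariance c ≠ 0) : 2 * (p : ℤ) ≤ scaledVariance c := by
  obtain ⟨t, ht⟩ := h
  rw [← scaledVariance_sub_const c t] at h0 ⊢
  have hs : ∑ i, (c i - t) = 0 := by simp [sum_sub_distrib, ht]
  clear ht
  generalize hb : (fun i => c i - t) = b at h0 ⊢
  have hs' : ∑ i, b i = 0 := by rw [← hb]; exact hs
  unfold scaledVariance at h0 ⊢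
  rw [hs'] at h0 ⊢
  have heven : (2 : ℤ) ∣ ∑ i, b i ^ 2 := by
    have : ∑ i, b i ^ 2 = ∑ i, (b i * (b i - 1)) + ∑ i, b i := by
      rw [← sum_add_distrib]
      exact sum_congr rfl fun i _ => by ring
    rw [this, hs', add_zero]
    exact dvd_sum fun i _ => (Int.even_mul_pred_self (b i)).two_dvd
  have hnn : 0 ≤ ∑ i, b i ^ 2 := sum_nonneg fun i _ => sq_nonneg _
  have hne : ∑ i, b i ^ 2 ≠ 0 := by
    intro h
    simp [h] at h0
  have : 2 ≤ ∑ i, b i ^ 2 := by omega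
  nlinarith

/-- A translation replaces the sum by its residue r mod p. If 0 < r < p, then b ≤ b² gives a
variance of at least pr - r² = r(p - r) ≥ p - 1. -/
theorem sub_one_le_scaledVariance {p : ℕ} (hp : 0 < p) (c : Fin p → ℤ)
    (h0 : scaledVariance c ≠ 0) : (p : ℤ) - 1 ≤ scaledVariance c := by
  by_cases h : (p : ℤ) ∣ ∑ i, c i
  · have := two_mul_le_scaledVariance c h h0
    omega
  rw [← scaledVariance_sub_const c ((∑ i, c i) / p)]
  set t := (∑ i, c i) / p
  have hs : ∑ i, (c i - t) = (∑ i, c i) % p := by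
    simp only [sum_sub_distrib, sum_const, card_univ, Fintype.card_fin, nsmul_eq_mul]
    rw [Int.emod_def]
  have hr0 : (∑ i, c i) % p ≠ 0 := fun h' => h (Int.dvd_of_emod_eq_zero h')
  have hr1 := Int.emod_nonneg (∑ i, c i) (b := (p : ℤ)) (by omega)
  have hr2 := Int.emod_lt_of_pos (∑ i, c i) (b := (p : ℤ)) (by omega)
  unfold scaledVariance
  rw [hs]
  generalize (∑ i, c i) % p = r at *
  have hle : r ≤ ∑ i, (c i - t) ^ 2 := by
    rw [← hs]
    exact sum_le_sum fun i _ => Int.le_self_sq _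
  have h1 : (p : ℤ) * r ≤ p * ∑ i, (c i - t) ^ 2 := by gcongr
  have h2 : 0 ≤ (r - 1) * (p - r - 1) := mul_nonneg (by omega) (by omega)
  nlinarith

theorem scaledVariance_nonneg {p : ℕ} (hp : 0 < p) (c : Fin p → ℤ) : 0 ≤ scaledVariance c := by
  by_cases h : scaledVariance c = 0
  · exact h.ge
  · have := sub_one_le_scaledVariance hp c h
    omega

/-- Two nonconstant blocks contribute p - 1 each. If only one block is nonconstant, the others have
sums divisible by p, hence so does that one, and it alone contributes 2p. -/
theorem two_mul_sub_one_le_sum_scaledVariance {p q : ℕ} (hp : p.Prime) (c : Fin q → Fin p → ℤ)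
    (h : (p : ℤ) ∣ ∑ j, ∑ i, c j i) (h0 : ∑ j, scaledVariance (c j) ≠ 0) :
    2 * ((p : ℤ) - 1) ≤ ∑ j, scaledVariance (c j) := by
  have hnn := fun j => scaledVariance_nonneg hp.pos (c j)
  obtain ⟨a, -, ha⟩ := exists_ne_zero_of_sum_ne_zero h0
  by_cases hb : ∃ b, b ≠ a ∧ scaledVariance (c b) ≠ 0
  · obtain ⟨b, hba, hb⟩ := hb
    have h1 := sub_one_le_scaledVariance hp.pos _ ha
    have h2 := sub_one_le_scaledVariance hp.pos _ hb
    have h3 : ∑ j ∈ {b, a}, scaledVariance (c j) ≤ ∑ j, scaledVariance (c j) :=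
      sum_le_sum_of_subset_of_nonneg (subset_univ _) fun j _ _ => hnn j
    rw [sum_pair hba] at h3
    omega
  · push Not at hb
    have hdvd : (p : ℤ) ∣ ∑ i, c a i := by
      rw [← add_sum_erase _ _ (mem_univ a)] at h
      refine (dvd_add_left (dvd_sum fun j hj => ?_)).1 h
      have hj0 := hb j (ne_of_mem_erase hj)
      refine (Nat.prime_iff_prime_int.1 hp).dvd_of_dvd_pow (n := 2) ⟨∑ i, c j i ^ 2, ?_⟩
      unfold scaledVariance at hj0
      linarith
    have h1 := two_mul_le_scaledVariance _ hdvd ha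
    have h2 := single_le_sum (fun j _ => hnn j) (mem_univ a)
    linarith

end Finset

/-! ### Mean squares of Galois conjugates -/

-- Frequencies divisible by p see only the sums of c over residue classes mod q, and `ζ ^ p` has
-- order q. Subtracting Parseval for these sums from Parseval for c leaves the variances within the
-- classes.
open Finset in
theorem IsPrimitiveRoot.sum_norm_sq_fourier_not_dvd {p q : ℕ} {ζ : ℂ}
    (hζ : IsPrimitiveRoot ζ (p * q)) (hp : p ≠ 0) (hq : q ≠ 0) (c : Fin (p * q) → ℤ) :
    ∑ u ∈ range (p * q) with ¬ p ∣ u, ‖∑ x, (c x : ℂ) * ζ ^ (u * (x : ℕ))‖ ^ 2 =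
      q * ((∑ j, scaledVariance fun i => c (finProdFinEquiv (i, j)) : ℤ) : ℝ) := by
  have hpq : p * q ≠ 0 := mul_ne_zero hp hq
  have hζp : IsPrimitiveRoot (ζ ^ p) q := hζ.pow (by omega) rfl
  have hall := hζ.sum_norm_sq_fourier hpq c
  have hsub := hζp.sum_norm_sq_fourier hq fun j => ∑ i, c (finProdFinEquiv (i, j))
  have hdvd : ∑ u ∈ range (p * q) with p ∣ u, ‖∑ x, (c x : ℂ) * ζ ^ (u * (x : ℕ))‖ ^ 2 =
      ∑ v ∈ range q, ‖∑ j : Fin q, ((∑ i, c (finProdFinEquiv (i, j)) : ℤ) : ℂ) *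
        (ζ ^ p) ^ (v * (j : ℕ))‖ ^ 2 := by
    symm
    refine sum_bij' (fun v _ => p * v) (fun u _ => u / p) ?_ ?_ ?_ ?_ ?_
    · intro v hv
      simp only [mem_filter, mem_range] at hv ⊢
      exact ⟨Nat.mul_lt_mul_of_pos_left hv (by omega), dvd_mul_right _ _⟩
    · intro u hu
      simp only [mem_filter, mem_range] at hu ⊢
      exact Nat.div_lt_of_lt_mul hu.1
    · intro v _
      exact Nat.mul_div_cancel_left v (by omega)
    · intro u hu
      exact Nat.mul_div_cancel' (mem_filter.1 hu).2
    · intro v _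
      congr 2
      rw [← finProdFinEquiv.sum_comp, Fintype.sum_prod_type_right]
      refine sum_congr rfl fun j _ => ?_
      rw [Int.cast_sum, sum_mul]
      refine sum_congr rfl fun i _ => ?_
      congr 1
      rw [finProdFinEquiv_apply_val, ← pow_mul]
      have : p * v * ((j : ℕ) + q * i) = p * (v * j) + (p * q) * (v * i) := by ring
      rw [this, pow_add, pow_mul ζ (p * q), hζ.pow_eq_one, one_pow, mul_one]
  have hsplit := sum_filter_add_sum_filter_not (range (p * q)) (fun u => p ∣ u)
    fun u => ‖∑ x, (c x : ℂ) * ζ ^ (u * (x : ℕ))‖ ^ 2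
  rw [hall, hdvd, hsub, ← finProdFinEquiv.sum_comp, Fintype.sum_prod_type_right] at hsplit
  rw [← eq_sub_iff_add_eq'] at hsplit
  rw [hsplit]
  unfold scaledVariance
  push_cast
  rw [sum_sub_distrib, ← mul_sum]
  ring

open Finset in
/-- The mean square of the Galois conjugates of a nonzero element of `(1 - ζ) ℤ[ζ]` is at least `2`,
for `ζ` of prime power order. -/
theorem IsPrimitiveRoot.two_mul_totient_le_sum_norm_sq {p k : ℕ} (hp : p.Prime) {ζ : ℂ}
    (hζ : IsPrimitiveRoot ζ (p ^ (k + 1))) (c : Fin (p ^ (k + 1)) → ℤ) (hc : (p : ℤ) ∣ ∑ x, c x)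
    (h0 : ∑ x, (c x : ℂ) * ζ ^ (x : ℕ) ≠ 0) :
    2 * ((p ^ (k + 1)).totient : ℝ) ≤
      ∑ u ∈ range (p ^ (k + 1)) with (p ^ (k + 1)).Coprime u,
        ‖∑ x, (c x : ℂ) * ζ ^ (u * (x : ℕ))‖ ^ 2 := by
  have hcop : ∀ u, (p ^ (k + 1)).Coprime u ↔ ¬ p ∣ u := fun u => by
    rw [Nat.coprime_pow_left_iff k.succ_pos, hp.coprime_iff_not_dvd]
  simp_rw [hcop]
  rw [Nat.totient_prime_pow_succ hp]
  generalize hn : p ^ (k + 1) = n at *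
  obtain rfl : n = p * p ^ k := by rw [← hn, pow_succ']
  have hq : p ^ k ≠ 0 := pow_ne_zero _ hp.ne_zero
  have hsum := hζ.sum_norm_sq_fourier_not_dvd hp.ne_zero hq c
  have hpos : 0 < ∑ u ∈ range (p * p ^ k) with ¬ p ∣ u,
      ‖∑ x, (c x : ℂ) * ζ ^ (u * (x : ℕ))‖ ^ 2 := by
    -- The term u = 1 is the given nonzero element.
    refine sum_pos' (fun _ _ => by positivity) ⟨1, ?_, ?_⟩
    · simp only [mem_filter, mem_range]
      refine ⟨?_, hp.one_lt.not_ge ∘ Nat.le_of_dvd one_pos⟩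
      calc 1 < p := hp.one_lt
        _ ≤ p * p ^ k := Nat.le_mul_of_pos_right _ (by omega)
    · simp only [one_mul]
      positivity
  rw [hsum] at hpos ⊢
  have hne : ∑ j, scaledVariance (fun i => c (finProdFinEquiv (i, j))) ≠ 0 := by
    intro h
    rw [h] at hpos
    simp at hpos
  have hle := two_mul_sub_one_le_sum_scaledVariance hp
    (fun j i => c (finProdFinEquiv (i, j)))
    (by rwa [← Fintype.sum_prod_type_right (fun x => c (finProdFinEquiv x)),
      finProdFinEquiv.sum_comp]) hne
  have hle' : 2 * ((p : ℝ) - 1) ≤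
      ((∑ j, scaledVariance fun i => c (finProdFinEquiv (i, j)) : ℤ) : ℝ) := by exact_mod_cast hle
  have h1 : ((p ^ k * (p - 1) : ℕ) : ℝ) = (p ^ k : ℕ) * ((p : ℝ) - 1) := by
    rw [Nat.cast_mul, Nat.cast_sub hp.one_le, Nat.cast_one]
  rw [h1]
  have : (0 : ℝ) ≤ (p ^ k : ℕ) := by positivity
  nlinarith

/-! ### Character theory of finite groups -/

namespace Representation

variable {G V : Type*} [Group G] [AddCommGroup V] [Module ℂ V] [FiniteDimensional ℂ V]

theorem isIdempotentElem_average_powers {A : Type*} [Ring A] [Algebra ℂ A] {n : ℕ} (hn : n ≠ 0)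
    {a : A} (ha : a ^ n = 1) :
    IsIdempotentElem ((n : ℂ)⁻¹ • ∑ t ∈ Finset.range n, a ^ t) ∧
      a * ((n : ℂ)⁻¹ • ∑ t ∈ Finset.range n, a ^ t) =
        (n : ℂ)⁻¹ • ∑ t ∈ Finset.range n, a ^ t := by
  have hn' : (n : ℂ) ≠ 0 := by exact_mod_cast hn
  have h1 : a * ∑ t ∈ Finset.range n, a ^ t = ∑ t ∈ Finset.range n, a ^ t := by
    have := mul_geom_sum a n
    rw [ha, sub_self, sub_mul, one_mul, sub_eq_zero] at this
    exact this
  have h2 (t : ℕ) : a ^ t * ∑ t ∈ Finset.range n, a ^ t = ∑ t ∈ Finset.range n, a ^ t := by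
    induction t with
    | zero => simp
    | succ t ih => rw [pow_succ, mul_assoc, h1, ih]
  refine ⟨?_, by rw [mul_smul_comm, h1]⟩
  unfold IsIdempotentElem
  rw [smul_mul_smul_comm]
  nth_rw 1 [Finset.sum_mul]
  simp_rw [h2]
  rw [Finset.sum_const, Finset.card_range, ← Nat.cast_smul_eq_nsmul ℂ, smul_smul,
    mul_assoc, inv_mul_cancel₀ hn', mul_one]

/-- The values of a character on the powers of `g` are the power sums of the eigenvalues of `g`,
counted with multiplicity. -/
theorem exists_character_pow_eq (ρ : Representation ℂ G V) {g : G} {n : ℕ} (hn : n ≠ 0)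
    (hg : g ^ n = 1) {ζ : ℂ} (hζ : IsPrimitiveRoot ζ n) :
    ∃ m : Fin n → ℕ, ∀ u : ℕ, ρ.character (g ^ u) = ∑ x, (m x : ℂ) * ζ ^ (u * (x : ℕ)) := by
  have hn' : (n : ℂ) ≠ 0 := by exact_mod_cast hn
  have hζ0 : ζ ≠ 0 := hζ.ne_zero hn
  let a : Fin n → Module.End ℂ V := fun x => (ζ⁻¹ ^ (x : ℕ)) • ρ g
  have ha (x : Fin n) : a x ^ n = 1 := by
    simp only [a, smul_pow, ← map_pow, hg, map_one]
    rw [pow_right_comm, inv_pow, hζ.pow_eq_one]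
    simp
  -- `E x` is the projection onto the eigenspace of `ρ g` for `ζ ^ x`, so its rank is the
  -- multiplicity sought.
  let E : Fin n → Module.End ℂ V := fun x => (n : ℂ)⁻¹ • ∑ t ∈ Finset.range n, a x ^ t
  have hE (x : Fin n) := isIdempotentElem_average_powers hn (ha x)
  have hgE (x : Fin n) : ρ g * E x = ζ ^ (x : ℕ) • E x := by
    have h := (hE x).2
    change a x * E x = E x at h
    conv_rhs => rw [← h]
    simp only [a, smul_mul_assoc, smul_smul, ← mul_pow, mul_inv_cancel₀ hζ0, one_pow, one_smul]
  have hguE (u : ℕ) (x : Fin n) : ρ (g ^ u) * E x = ζ ^ (u * (x : ℕ)) • E x := by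
    induction u with
    | zero => simp
    | succ u ih =>
      rw [pow_succ, map_mul, mul_assoc, hgE, mul_smul_comm, ih, smul_smul, ← pow_add]
      congr 2
      ring
  have hsum : ∑ x, E x = 1 := by
    have hgeom (t : ℕ) (ht : t ∈ Finset.range n) :
        ∑ x : Fin n, (ζ⁻¹ ^ (x : ℕ)) ^ t = if t = 0 then (n : ℂ) else 0 := by
      split_ifs with h
      · simp [h]
      · have h1 : ζ⁻¹ ^ t ≠ 1 := hζ.inv.pow_ne_one_of_pos_of_lt h (Finset.mem_range.1 ht)
        rw [Fin.sum_univ_eq_sum_range fun x => (ζ⁻¹ ^ x) ^ t]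
        simp_rw [pow_right_comm ζ⁻¹ _ t]
        rw [geom_sum_eq h1, pow_right_comm, hζ.inv.pow_eq_one]
        simp
    simp only [E, ← Finset.smul_sum]
    rw [Finset.sum_comm]
    simp only [a, smul_pow, ← Finset.sum_smul]
    rw [Finset.sum_congr rfl fun t ht => by rw [hgeom t ht]]
    simp only [ite_smul, zero_smul, Finset.sum_ite_eq', Finset.mem_range, Nat.pos_of_ne_zero hn,
      if_true, pow_zero, smul_smul, inv_mul_cancel₀ hn', one_smul]
  refine ⟨fun x => Module.finrank ℂ (LinearMap.range (E x)), fun u => ?_⟩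
  have htr (x : Fin n) :
      LinearMap.trace ℂ V (E x) = (Module.finrank ℂ (LinearMap.range (E x)) : ℂ) :=
    (LinearMap.IsIdempotentElem.isProj_range (E x) (hE x).1).trace
  rw [character, ← mul_one (ρ (g ^ u)), ← hsum, Finset.mul_sum, map_sum]
  refine Finset.sum_congr rfl fun x _ => ?_
  rw [hguE, map_smul, htr, smul_eq_mul, mul_comm]

theorem character_inv [Finite G] (ρ : Representation ℂ G V) (g : G) :
    ρ.character g⁻¹ = (starRingEnd ℂ) (ρ.character g) := by
  set n := Nat.card G
  have hn : n ≠ 0 := Nat.card_pos.ne'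
  have hζ := Complex.isPrimitiveRoot_exp n hn
  generalize Complex.exp _ = ζ at hζ
  obtain ⟨m, hm⟩ := ρ.exists_character_pow_eq hn (pow_card_eq_one' (x := g)) hζ
  have hconj : (starRingEnd ℂ) ζ = ζ⁻¹ :=
    (Complex.inv_eq_conj (Complex.norm_eq_one_of_pow_eq_one hζ.pow_eq_one hn)).symm
  have h1 : g⁻¹ = g ^ (n - 1) := by
    rw [inv_eq_iff_mul_eq_one, ← pow_succ', Nat.sub_add_cancel (by omega), pow_card_eq_one']
  have h2 : ζ⁻¹ = ζ ^ (n - 1) := by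
    apply inv_eq_of_mul_eq_one_right
    rw [← pow_succ', Nat.sub_add_cancel (by omega), hζ.pow_eq_one]
  have h3 := hm 1
  rw [pow_one] at h3
  rw [h1, hm, h3, map_sum]
  refine Finset.sum_congr rfl fun x _ => ?_
  rw [map_mul, map_pow, hconj, h2, Complex.conj_natCast, ← pow_mul, one_mul]

theorem IsIrreducible.exists_eq_smul_one {ρ : Representation ℂ G V} (hρ : ρ.IsIrreducible)
    (T : Module.End ℂ V) (hT : ∀ g, Commute T (ρ g)) : ∃ c : ℂ, T = c • 1 := by
  let f : IntertwiningMap ρ ρ := ⟨T, fun g => (hT g).eq⟩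
  obtain ⟨c, hc⟩ := (algebraMap_intertwiningMap_bijective_of_isAlgClosed (ρ := ρ)).2 f
  refine ⟨c, ?_⟩
  have := congrArg IntertwiningMap.toLinearMap hc
  exact this.symm

omit [FiniteDimensional ℂ V] in
theorem IsIrreducible.nontrivial {ρ : Representation ℂ G V} (hρ : ρ.IsIrreducible) :
    Nontrivial V := by
  by_contra h
  rw [not_nontrivial_iff_subsingleton] at h
  obtain ⟨a, b, hab⟩ := hρ.toNontrivial
  apply hab
  ext x
  rw [Subsingleton.elim x 0]
  exact ⟨fun _ => b.toSubmodule.zero_mem, fun _ => a.toSubmodule.zero_mem⟩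

theorem IsIrreducible.finrank_ne_zero {ρ : Representation ℂ G V} (hρ : ρ.IsIrreducible) :
    (Module.finrank ℂ V : ℂ) ≠ 0 := by
  have := hρ.nontrivial
  exact_mod_cast (Module.finrank_pos (R := ℂ) (M := V)).ne'

theorem IsIrreducible.eq_trace_smul_one {ρ : Representation ℂ G V} (hρ : ρ.IsIrreducible)
    (T : Module.End ℂ V) (hT : ∀ g, Commute T (ρ g)) :
    T = (LinearMap.trace ℂ V T / Module.finrank ℂ V) • 1 := by
  obtain ⟨c, rfl⟩ := hρ.exists_eq_smul_one T hT
  rw [map_smul, LinearMap.trace_one, smul_eq_mul, mul_div_cancel_right₀ _ hρ.finrank_ne_zero]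

/-- The sum over conjugates commutes with the action, so Schur's lemma makes it a scalar, found by
taking traces. -/
theorem IsIrreducible.sum_conj [Fintype G] {ρ : Representation ℂ G V} (hρ : ρ.IsIrreducible)
    (x : G) :
    ∑ h, ρ (h * x * h⁻¹) =
      ((Nat.card G : ℂ) * ρ.character x / Module.finrank ℂ V) • (1 : Module.End ℂ V) := by
  rw [hρ.eq_trace_smul_one (∑ h, ρ (h * x * h⁻¹))]
  · congr 2
    rw [map_sum]
    change ∑ h, ρ.character (h * x * h⁻¹) = _
    simp
  · intro g
    unfold Commute SemiconjBy
    rw [Finset.sum_mul, Finset.mul_sum]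
    simp_rw [← map_mul]
    rw [← Equiv.sum_comp (Equiv.mulLeft g)]
    refine Finset.sum_congr rfl fun h _ => ?_
    simp [mul_assoc]

theorem IsIrreducible.sum_character_conj_mul [Fintype G] {ρ : Representation ℂ G V}
    (hρ : ρ.IsIrreducible) (x y : G) :
    ∑ h, ρ.character (h * x * h⁻¹ * y) =
      (Nat.card G : ℂ) * ρ.character x / Module.finrank ℂ V * ρ.character y := by
  have := congrArg (fun T => LinearMap.trace ℂ V (T * ρ y)) (hρ.sum_conj x)
  simpa [Finset.sum_mul, map_sum, ← map_mul, character] using this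

theorem IsIrreducible.sum_norm_sq_character [Fintype G] {ρ : Representation ℂ G V}
    (hρ : ρ.IsIrreducible) : ∑ g, ‖ρ.character g‖ ^ 2 = Nat.card G := by
  have h0 : (Nat.card G : ℂ) ≠ 0 := by exact_mod_cast Nat.card_pos.ne'
  have : Invertible (Nat.card G : ℂ) := invertibleOfNonzero h0
  have h := card_inv_mul_sum_char_mul_char_eq_finrank ρ ρ
  rw [IsIrreducible.finrank_intertwiningMap_self, Nat.cast_one, inv_mul_eq_one₀ h0] at h
  simp_rw [character_inv, Complex.mul_conj'] at h
  exact_mod_cast h.symm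

/-- The degree of an irreducible complex representation divides the order of the group. -/
theorem IsIrreducible.finrank_dvd_card [Finite G] {ρ : Representation ℂ G V}
    (hρ : ρ.IsIrreducible) : Module.finrank ℂ V ∣ Nat.card G := by
  classical
  have := Fintype.ofFinite G
  set n := Nat.card G with hn_def
  have hn : n ≠ 0 := Nat.card_pos.ne'
  have hζ := Complex.isPrimitiveRoot_exp n hn
  generalize Complex.exp _ = ζ at hζ
  have hd := hρ.finrank_ne_zero
  have := hρ.nontrivial
  obtain ⟨v, hv⟩ := exists_ne (0 : V)
  have hT : ∑ h, ρ.character h⁻¹ • ρ h = ((n : ℂ) / Module.finrank ℂ V) • (1 : Module.End ℂ V) := by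
    rw [hρ.eq_trace_smul_one (∑ h, ρ.character h⁻¹ • ρ h)]
    · congr 2
      rw [map_sum]
      have h := hρ.sum_norm_sq_character
      simp only [map_smul, character_inv, smul_eq_mul]
      change ∑ h, (starRingEnd ℂ) (ρ.character h) * ρ.character h = _
      simp_rw [Complex.conj_mul']
      exact_mod_cast h
    · intro g
      unfold Commute SemiconjBy
      rw [Finset.sum_mul, Finset.mul_sum, ← (MulAut.conj g).toEquiv.sum_comp]
      refine Finset.sum_congr rfl fun h _ => ?_
      simp only [smul_mul_assoc, mul_smul_comm, ← map_mul, MulEquiv.toEquiv_eq_coe,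
        EquivLike.coe_coe, MulAut.conj_apply]
      rw [show (g * h * g⁻¹)⁻¹ = g * h⁻¹ * g⁻¹ by group, char_conj, inv_mul_cancel_right]
  -- A finitely generated ℤ-module, stable under G and ζ. The operator of `hT` preserves it and acts
  -- as the scalar n / dim V, which is therefore an algebraic integer.
  let N : Submodule ℤ V :=
    Submodule.span ℤ (Set.range fun a : Fin n × G => ζ ^ (a.1 : ℕ) • ρ a.2 v)
  have hmem (i : ℕ) (g : G) : ζ ^ i • ρ g v ∈ N := by
    rw [← pow_mod_orderOf, ← hζ.eq_orderOf]
    exact Submodule.subset_span ⟨(⟨i % n, Nat.mod_lt _ (by omega)⟩, g), rfl⟩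
  have hint : IsIntegral ℤ ((n : ℂ) / Module.finrank ℂ V) := by
    refine isIntegral_of_smul_mem_submodule N ?_ (Submodule.fg_span (Set.finite_range _)) _ ?_
    · intro h
      have := hmem 0 1
      rw [h] at this
      simp [hv] at this
    · intro w hw
      have hw' : ((n : ℂ) / Module.finrank ℂ V) • w = ∑ h, ρ.character h⁻¹ • ρ h w := by
        simpa using (congrArg (fun T : Module.End ℂ V => T w) hT).symm
      rw [hw']
      clear hw'
      refine sum_mem fun h _ => ?_
      induction hw using Submodule.span_induction with
      | mem w hw =>
        obtain ⟨⟨i, g⟩, rfl⟩ := hw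
        obtain ⟨m, hm⟩ := ρ.exists_character_pow_eq hn (pow_card_eq_one' (x := h⁻¹)) hζ
        have h1 := hm 1
        rw [pow_one] at h1
        rw [h1, Finset.sum_smul]
        refine sum_mem fun x _ => ?_
        have : ((m x : ℂ) * ζ ^ (1 * (x : ℕ))) • ρ h (ζ ^ (i : ℕ) • ρ g v) =
            (m x) • (ζ ^ ((x : ℕ) + i) • ρ (h * g) v) := by
          rw [map_smul, smul_smul, ← Nat.cast_smul_eq_nsmul ℂ, smul_smul, map_mul,
            Module.End.mul_apply, pow_add, one_mul, mul_assoc]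
        rw [this]
        exact nsmul_mem (hmem _ _) _
      | zero => simp
      | add x y _ _ hx hy => rw [map_add, smul_add]; exact add_mem hx hy
      | smul a x _ hx =>
        rw [map_zsmul, smul_comm]
        exact N.smul_mem a hx
  have hq : IsIntegral ℤ ((n : ℚ) / Module.finrank ℂ V) := by
    rw [← isIntegral_algebraMap_iff (B := ℂ) (algebraMap ℚ ℂ).injective]
    simpa using hint
  obtain ⟨z, hz⟩ := IsIntegrallyClosed.isIntegral_iff.1 hq
  have hdq : (Module.finrank ℂ V : ℚ) ≠ 0 := by exact_mod_cast hd
  have hz' : (n : ℚ) = Module.finrank ℂ V * z := by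
    rw [eq_div_iff hdq] at hz
    rw [← hz, mul_comm]
    rfl
  rw [← Int.natCast_dvd_natCast]
  exact ⟨z, by exact_mod_cast hz'⟩

/-- If `G` induces only inner automorphisms on the image of `P`, then the restriction to `P` of an
irreducible character of `G` is proportional to an irreducible character of `P`. -/
theorem IsIrreducible.exists_character_restrict_proportional {P : Type*} [Group P] [Finite G]
    {ρ : Representation ℂ G V} (hρ : ρ.IsIrreducible) (f : P →* G)
    (hf : ∀ g : G, ∃ k : P, ∀ x, g * f x * g⁻¹ = f (k * x * k⁻¹)) :
    ∃ (W : Submodule ℂ V) (σ : Representation ℂ P W), σ.IsIrreducible ∧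
      ∀ x, σ.character x / Module.finrank ℂ W = ρ.character (f x) / Module.finrank ℂ V := by
  have := Fintype.ofFinite G
  have := hρ.nontrivial
  let τ : Representation ℂ P V := ρ.comp f
  have hwf : WellFoundedLT (Subrepresentation τ) :=
    StrictMono.wellFoundedLT (f := fun s => Module.finrank ℂ s.toSubmodule)
      fun _ _ hab => Submodule.finrank_lt_finrank_of_lt hab
  have hbt : (⊤ : Subrepresentation τ) ≠ ⊥ := by
    intro h
    have h' := congrArg Subrepresentation.toSubmodule h
    exact (bot_ne_top (α := Submodule ℂ V)) h'.symm
  -- By finite dimension, V contains a minimal nonzero P-stable subspace; it carries the required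
  -- character.
  obtain ⟨S, hS, -⟩ := (IsAtomic.eq_bot_or_exists_atom_le (⊤ : Subrepresentation τ)).resolve_left hbt
  have hirr : S.toRepresentation.IsIrreducible := by
    have lift (Q : Subrepresentation S.toRepresentation) : ∃ R : Subrepresentation τ, R ≤ S ∧
        R.toSubmodule = Q.toSubmodule.map S.toSubmodule.subtype := by
      refine ⟨⟨Q.toSubmodule.map S.toSubmodule.subtype, ?_⟩, Submodule.map_subtype_le _ _, rfl⟩
      rintro g _ ⟨w, hw, rfl⟩
      exact ⟨_, Q.apply_mem_toSubmodule g hw, rfl⟩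
    have hinj := Submodule.map_injective_of_injective S.toSubmodule.injective_subtype
    refine { exists_pair_ne := ⟨⊥, ⊤, fun h => hS.1 ?_⟩, eq_bot_or_eq_top := fun Q => ?_ }
    · have h' := congrArg Subrepresentation.toSubmodule h
      apply Subrepresentation.toSubmodule_injective
      have h2 := congrArg (Submodule.map S.toSubmodule.subtype) h'
      change Submodule.map S.toSubmodule.subtype ⊥ = Submodule.map S.toSubmodule.subtype ⊤ at h2
      rw [Submodule.map_bot, Submodule.map_subtype_top] at h2
      exact h2.symm
    · obtain ⟨R, hRS, hR⟩ := lift Q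
      rcases hS.le_iff.1 hRS with rfl | rfl
      · left
        apply Subrepresentation.toSubmodule_injective
        apply hinj
        rw [← hR]
        exact (Submodule.map_bot _).symm
      · right
        apply Subrepresentation.toSubmodule_injective
        apply hinj
        rw [← hR]
        exact (Submodule.map_subtype_top _).symm
  refine ⟨S.toSubmodule, S.toRepresentation, hirr, fun x => ?_⟩
  choose k hk using hf
  have hc0 : (Nat.card G : ℂ) ≠ 0 := by exact_mod_cast Nat.card_pos.ne'
  have hW0 := hirr.finrank_ne_zero
  -- The sum over G-conjugates of `f x` is scalar on V, hence on S. There each term is a P-conjugate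
  -- of x, so the trace on S gives the proportionality.
  have key : ∑ h : G, S.toRepresentation (k h * x * (k h)⁻¹) =
      ((Nat.card G : ℂ) * ρ.character (f x) / Module.finrank ℂ V) • 1 := by
    ext w
    have h := congrArg (fun T : Module.End ℂ V => T w) (hρ.sum_conj (f x))
    simp only [hk] at h
    simpa [Subrepresentation.toRepresentation, τ] using h
  have htr := congrArg (LinearMap.trace ℂ S.toSubmodule) key
  rw [map_sum, map_smul, LinearMap.trace_one] at htr
  change ∑ h : G, S.toRepresentation.character (k h * x * (k h)⁻¹) = _ at htr
  simp only [char_conj, Finset.sum_const, Finset.card_univ, nsmul_eq_mul, smul_eq_mul] at htr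
  rw [Fintype.card_eq_nat_card] at htr
  rw [div_eq_iff hW0]
  apply mul_left_cancel₀ hc0
  rw [htr]
  ring

end Representation

/-! ### Support of a character of a p-group -/

namespace Representation

/-- In a `p`-group, a character of degree divisible by `p` has mean square at least `2` on the
nonidentity elements where it does not vanish. -/
theorem IsIrreducible.two_mul_card_support_le {P W : Type*} [Group P] [Finite P] [AddCommGroup W]
    [Module ℂ W] [FiniteDimensional ℂ W] {σ : Representation ℂ P W} (hσ : σ.IsIrreducible)
    {p : ℕ} (hp : p.Prime) (hP : IsPGroup p P) (hd : p ∣ Module.finrank ℂ W) :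
    2 * ((Nat.card {g // σ.character g ≠ 0} : ℝ) - 1) ≤
      (Nat.card P : ℝ) - (Module.finrank ℂ W : ℝ) ^ 2 := by
  classical
  have := Fintype.ofFinite P
  have : Fact p.Prime := ⟨hp⟩
  obtain ⟨k, hk⟩ := IsPGroup.iff_card.1 hP
  obtain _ | k := k
  · have h := hd.trans hσ.finrank_dvd_card
    rw [hk, pow_zero, Nat.dvd_one] at h
    exact absurd h hp.ne_one
  have hn : p ^ (k + 1) ≠ 0 := pow_ne_zero _ hp.ne_zero
  have hζ := Complex.isPrimitiveRoot_exp _ hn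
  generalize Complex.exp _ = ζ at hζ
  set U := {u ∈ Finset.range (p ^ (k + 1)) | (p ^ (k + 1)).Coprime u} with hU
  have hUcard : U.card = (p ^ (k + 1)).totient := (Nat.totient_eq_card_coprime _).symm
  have hφ : (0 : ℝ) < (p ^ (k + 1)).totient := by
    exact_mod_cast Nat.totient_pos.2 (Nat.pos_of_ne_zero hn)
  have hge (g : P) : (if σ.character g ≠ 0 then 2 * ((p ^ (k + 1)).totient : ℝ) else 0) ≤
      ∑ u ∈ U, ‖σ.character (g ^ u)‖ ^ 2 := by
    split_ifs with h
    · obtain ⟨m, hm⟩ := σ.exists_character_pow_eq hn (g := g) (by rw [← hk, pow_card_eq_one']) hζ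
      simp_rw [hm]
      have h0 := hm 0
      have h1 := hm 1
      simp only [pow_zero, zero_mul, mul_one, char_one, one_mul, pow_one] at h0 h1
      rw [h1] at h
      have h0' : Module.finrank ℂ W = ∑ x, m x := by exact_mod_cast h0
      have := hζ.two_mul_totient_le_sum_norm_sq hp (fun x => (m x : ℤ))
        (by rw [← Nat.cast_sum, ← h0']; exact_mod_cast hd) (by simpa using h)
      simpa only [Int.cast_natCast, hU] using this
    · positivity
  -- Raising to a power prime to |P| permutes P and fixes 1.
  have hperm (u : ℕ) (hu : u ∈ U) :
      ∑ g ∈ Finset.univ.erase (1 : P), ‖σ.character (g ^ u)‖ ^ 2 =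
        ∑ g ∈ Finset.univ.erase (1 : P), ‖σ.character g‖ ^ 2 := by
    have hcop : (Nat.card P).Coprime u := by
      rw [hk]
      exact (Finset.mem_filter.1 hu).2
    have h := Equiv.sum_comp (powCoprime hcop) fun g => ‖σ.character g‖ ^ 2
    rw [← Finset.add_sum_erase _ _ (Finset.mem_univ (1 : P)),
      ← Finset.add_sum_erase _ _ (Finset.mem_univ (1 : P))] at h
    simpa [powCoprime_apply] using h
  have hsum : ∑ g ∈ Finset.univ.erase (1 : P),
      (if σ.character g ≠ 0 then 2 * ((p ^ (k + 1)).totient : ℝ) else 0) ≤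
      (p ^ (k + 1)).totient * ∑ g ∈ Finset.univ.erase (1 : P), ‖σ.character g‖ ^ 2 := by
    refine (Finset.sum_le_sum fun g _ => hge g).trans_eq ?_
    rw [Finset.sum_comm, Finset.sum_congr rfl hperm, Finset.sum_const, hUcard, nsmul_eq_mul]
  have htot := hσ.sum_norm_sq_character
  rw [← Finset.add_sum_erase _ _ (Finset.mem_univ (1 : P)), char_one, Complex.norm_natCast] at htot
  have hcount : ∑ g : P, (if σ.character g ≠ 0 then 2 * ((p ^ (k + 1)).totient : ℝ) else 0) =
      Nat.card {g // σ.character g ≠ 0} * (2 * (p ^ (k + 1)).totient) := by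
    rw [← Finset.sum_filter, Finset.sum_const, nsmul_eq_mul, Nat.card_eq_fintype_card,
      Fintype.card_subtype]
  rw [← Finset.add_sum_erase _ _ (Finset.mem_univ (1 : P)),
    if_pos (by rw [char_one]; exact hσ.finrank_ne_zero)] at hcount
  have h2 : ((p ^ (k + 1)).totient : ℝ) * (2 * ((Nat.card {g // σ.character g ≠ 0} : ℝ) - 1)) ≤
      (p ^ (k + 1)).totient * ((Nat.card P : ℝ) - (Module.finrank ℂ W : ℝ) ^ 2) := by
    have : ∑ g ∈ Finset.univ.erase (1 : P), ‖σ.character g‖ ^ 2 =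
        (Nat.card P : ℝ) - (Module.finrank ℂ W : ℝ) ^ 2 := by linarith
    rw [← this]
    linarith
  exact le_of_mul_le_mul_left h2 hφ

/-! ### Characters of direct products -/

section Pi

variable {ι : Type*} [Fintype ι] [DecidableEq ι] {P : ι → Type*} [∀ i, Group (P i)]
  [∀ i, Finite (P i)] {V : Type*} [AddCommGroup V] [Module ℂ V] [FiniteDimensional ℂ V]
  {ρ : Representation ℂ (∀ i, P i) V}

/-- Conjugating the factor in coordinate a by g amounts to conjugating by `g a` alone, which
commutes with y. So all terms of `sum_character_conj_mul` coincide. -/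
theorem IsIrreducible.character_mulSingle_mul (hρ : ρ.IsIrreducible) (a : ι) (x : P a)
    (y : ∀ i, P i) (hy : y a = 1) :
    ρ.character (Pi.mulSingle a x * y) / Module.finrank ℂ V =
      ρ.character (Pi.mulSingle a x) / Module.finrank ℂ V *
        (ρ.character y / Module.finrank ℂ V) := by
  have := Fintype.ofFinite (∀ i, P i)
  have h := hρ.sum_character_conj_mul (Pi.mulSingle a x) y
  have hconj (g : ∀ i, P i) : ρ.character (g * Pi.mulSingle a x * g⁻¹ * y) =
      ρ.character (Pi.mulSingle a x * y) := by
    have : g * Pi.mulSingle a x * g⁻¹ * y =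
        Pi.mulSingle a (g a) * (Pi.mulSingle a x * y) * (Pi.mulSingle a (g a))⁻¹ := by
      ext i
      by_cases hi : i = a
      · subst hi
        simp [hy]
      · simp [hi]
    rw [this, char_conj]
  simp only [hconj, Finset.sum_const, Finset.card_univ, nsmul_eq_mul] at h
  rw [Fintype.card_eq_nat_card, mul_div_assoc, mul_assoc] at h
  have hc0 : (Nat.card (∀ i, P i) : ℂ) ≠ 0 := by exact_mod_cast Nat.card_pos.ne'
  rw [mul_left_cancel₀ hc0 h]
  ring

theorem IsIrreducible.character_div_finrank_eq_prod (hρ : ρ.IsIrreducible) (g : ∀ i, P i) :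
    ρ.character g / Module.finrank ℂ V =
      ∏ i, ρ.character (Pi.mulSingle i (g i)) / Module.finrank ℂ V := by
  have h (s : Finset ι) : ρ.character (fun i => if i ∈ s then g i else 1) / Module.finrank ℂ V =
      ∏ i ∈ s, ρ.character (Pi.mulSingle i (g i)) / Module.finrank ℂ V := by
    induction s using Finset.induction_on with
    | empty =>
      have : (fun i => if i ∈ (∅ : Finset ι) then g i else 1) = 1 := by
        ext i
        simp
      rw [this, char_one, Finset.prod_empty, div_self hρ.finrank_ne_zero]
    | insert a s ha ih =>
      rw [Finset.prod_insert ha, ← ih, ← hρ.character_mulSingle_mul _ _ _ (by simp [ha])]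
      congr 2
      ext i
      by_cases hi : i = a
      · subst hi
        simp [ha]
      · simp [hi]
  simpa using h Finset.univ

omit [DecidableEq ι] in
/-- An irreducible character of a direct product is the product of irreducible characters of the
factors. -/
theorem IsIrreducible.exists_character_eq_prod (hρ : ρ.IsIrreducible) :
    ∃ (W : ι → Submodule ℂ V) (σ : ∀ i, Representation ℂ (P i) (W i)),
      (∀ i, (σ i).IsIrreducible) ∧ Module.finrank ℂ V = ∏ i, Module.finrank ℂ (W i) ∧
        ∀ g, ρ.character g = ∏ i, (σ i).character (g i) := by
  classical
  have := fun i => Fintype.ofFinite (P i)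
  have hex (i : ι) := hρ.exists_character_restrict_proportional (MonoidHom.mulSingle P i)
    fun g => ⟨g i, fun x => by
      ext j
      by_cases hj : j = i
      · subst hj
        simp
      · simp [hj]⟩
  choose W σ hσ hχ using hex
  have hd := hρ.finrank_ne_zero
  have hprod (g : ∀ i, P i) : ρ.character g / Module.finrank ℂ V =
      ∏ i, (σ i).character (g i) / Module.finrank ℂ (W i) := by
    rw [hρ.character_div_finrank_eq_prod]
    exact Finset.prod_congr rfl fun i _ => (hχ i (g i)).symm
  -- The normalized characters already multiply; comparing their second moments, |G| / d² on each
  -- side, identifies the degrees.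
  have hdeg : Module.finrank ℂ V = ∏ i, Module.finrank ℂ (W i) := by
    have hV : (Module.finrank ℂ V : ℝ) ≠ 0 := by exact_mod_cast hd
    have hW (i : ι) : (Module.finrank ℂ (W i) : ℝ) ≠ 0 := by exact_mod_cast (hσ i).finrank_ne_zero
    have hcard : (Nat.card (∀ i, P i) : ℝ) = ∏ i, (Nat.card (P i) : ℝ) := by
      rw [Nat.card_pi, Nat.cast_prod]
    have h1 : ∑ g : ∀ i, P i, ‖ρ.character g / Module.finrank ℂ V‖ ^ 2 =
        ∏ i, ∑ x : P i, ‖(σ i).character x / Module.finrank ℂ (W i)‖ ^ 2 := by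
      rw [Finset.prod_univ_sum, Fintype.piFinset_univ]
      refine Finset.sum_congr rfl fun g _ => ?_
      rw [hprod, norm_prod, Finset.prod_pow]
    simp only [norm_div, Complex.norm_natCast, div_pow, ← Finset.sum_div] at h1
    rw [hρ.sum_norm_sq_character] at h1
    simp_rw [fun i => (hσ i).sum_norm_sq_character] at h1
    rw [Finset.prod_div_distrib, ← hcard, Finset.prod_pow] at h1
    have hc0 : (Nat.card (∀ i, P i) : ℝ) ≠ 0 := by exact_mod_cast Nat.card_pos.ne'
    have h2 := inv_injective (mul_left_cancel₀ hc0 (by simpa only [div_eq_mul_inv] using h1))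
    have h3 := (pow_left_inj₀ (by positivity) (by positivity) two_ne_zero).1 h2
    exact_mod_cast h3
  refine ⟨W, σ, hσ, hdeg, fun g => ?_⟩
  have := hprod g
  rw [Finset.prod_div_distrib, ← Nat.cast_prod, ← hdeg, div_left_inj' hd] at this
  exact this

end Pi

/-! ### Multiplying the bounds over the factors -/

/-- A product form of the inequality `α (N - 1) ≤ A - a`. -/
theorem _root_.Finset.prod_mul_prod_sub_one_le {ι : Type*} (s : Finset ι) (α N A a : ι → ℝ)
    (hα : ∀ i ∈ s, 0 ≤ α i) (hN : ∀ i ∈ s, 1 ≤ N i) (ha : ∀ i ∈ s, α i ≤ a i)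
    (h : ∀ i ∈ s, α i * (N i - 1) ≤ A i - a i) :
    (∏ i ∈ s, α i) * (∏ i ∈ s, N i - 1) ≤ ∏ i ∈ s, A i - ∏ i ∈ s, a i := by
  classical
  induction s using Finset.induction_on with
  | empty => simp
  | insert i s hi ih =>
    simp only [Finset.forall_mem_insert] at hα hN ha h
    have ih := ih hα.2 hN.2 ha.2 h.2
    rw [Finset.prod_insert hi, Finset.prod_insert hi, Finset.prod_insert hi, Finset.prod_insert hi]
    have hβ : 0 ≤ ∏ i ∈ s, α i := Finset.prod_nonneg hα.2
    have hM : 1 ≤ ∏ i ∈ s, N i := Finset.one_le_prod hN.2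
    have hb : ∏ i ∈ s, α i ≤ ∏ i ∈ s, a i := Finset.prod_le_prod hα.2 ha.2
    generalize ∏ i ∈ s, α i = β at *
    generalize ∏ i ∈ s, N i = M at *
    generalize ∏ i ∈ s, A i = B at *
    generalize ∏ i ∈ s, a i = b at *
    -- After expansion, α ≤ a and β ≤ b bound the cross terms, and with x = N - 1, y = M - 1 one has
    -- NM - 1 = x + y + xy.
    have h1 : (a i + α i * (N i - 1)) * (b + β * (M - 1)) ≤ A i * B := by
      apply mul_le_mul (by linarith) (by linarith)
      · have := mul_nonneg hβ (sub_nonneg.2 hM)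
        linarith
      · have := mul_nonneg hα.1 (sub_nonneg.2 hN.1)
        linarith
    have h2 : α i * (β * (M - 1)) ≤ a i * (β * (M - 1)) :=
      mul_le_mul_of_nonneg_right ha.1 (mul_nonneg hβ (sub_nonneg.2 hM))
    have h3 : β * (α i * (N i - 1)) ≤ b * (α i * (N i - 1)) :=
      mul_le_mul_of_nonneg_right hb (mul_nonneg hα.1 (sub_nonneg.2 hN.1))
    nlinarith

/-- The bound on the support of an irreducible character of a direct product of groups of prime
power order. -/
theorem IsIrreducible.two_pow_mul_card_support_le_pi {ι : Type*} [Fintype ι]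
    {P : ι → Type*} [∀ i, Group (P i)] [∀ i, Finite (P i)] {p : ι → ℕ} (hp : ∀ i, (p i).Prime)
    (hP : ∀ i, IsPGroup (p i) (P i)) {V : Type*} [AddCommGroup V] [Module ℂ V]
    [FiniteDimensional ℂ V] {ρ : Representation ℂ (∀ i, P i) V} (hρ : ρ.IsIrreducible) :
    2 ^ (Module.finrank ℂ V).primeFactors.card *
        ((Nat.card {g // ρ.character g ≠ 0} : ℝ) - 1) ≤
      (Nat.card (∀ i, P i) : ℝ) - (Module.finrank ℂ V : ℝ) ^ 2 := by
  classical
  obtain ⟨W, σ, hσ, hdeg, hχ⟩ := hρ.exists_character_eq_prod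
  have hpow (i : ι) : ∃ k, Module.finrank ℂ (W i) = p i ^ k := by
    have : Fact (p i).Prime := ⟨hp i⟩
    obtain ⟨n, hn⟩ := IsPGroup.iff_card.1 (hP i)
    obtain ⟨k, -, hk⟩ := (Nat.dvd_prime_pow (hp i)).1 (hn ▸ (hσ i).finrank_dvd_card)
    exact ⟨k, hk⟩
  have hone (i : ι) : 1 ≤ Nat.card {x // (σ i).character x ≠ 0} := by
    rw [Nat.one_le_iff_ne_zero, Nat.card_ne_zero]
    exact ⟨⟨1, by rw [char_one]; exact (hσ i).finrank_ne_zero⟩, inferInstance⟩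
  let T : Finset ι := {i | p i ∣ Module.finrank ℂ (W i)}
  have hdeg_one (i : ι) (hi : i ∉ T) : Module.finrank ℂ (W i) = 1 := by
    obtain ⟨k, hk⟩ := hpow i
    obtain _ | k := k
    · simpa using hk
    · exact absurd (by simp [T, hk, pow_succ']) hi
  have hmain := Finset.prod_mul_prod_sub_one_le Finset.univ (fun i => if i ∈ T then (2 : ℝ) else 1)
    (fun i => (Nat.card {x // (σ i).character x ≠ 0} : ℝ)) (fun i => (Nat.card (P i) : ℝ))
    (fun i => (Module.finrank ℂ (W i) : ℝ) ^ 2)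
    (fun i _ => by split_ifs <;> norm_num) (fun i _ => by exact_mod_cast hone i)
    (fun i _ => by
      split_ifs with hi
      · have hpos : 0 < Module.finrank ℂ (W i) :=
          Nat.pos_of_ne_zero (by exact_mod_cast (hσ i).finrank_ne_zero)
        have h2 : 2 ≤ Module.finrank ℂ (W i) :=
          (hp i).two_le.trans (Nat.le_of_dvd hpos (Finset.mem_filter.1 hi).2)
        have h2' : (2 : ℝ) ≤ Module.finrank ℂ (W i) := by exact_mod_cast h2
        nlinarith
      · rw [hdeg_one i hi]
        norm_num)
    (fun i _ => by
      split_ifs with hi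
      · exact (hσ i).two_mul_card_support_le (hp i) (hP i) (Finset.mem_filter.1 hi).2
      · rw [hdeg_one i hi, one_mul]
        have : Nat.card {x // (σ i).character x ≠ 0} ≤ Nat.card (P i) := Finite.card_subtype_le _
        have : (Nat.card {x // (σ i).character x ≠ 0} : ℝ) ≤ Nat.card (P i) := by
          exact_mod_cast this
        norm_num
        linarith)
  have hN : Nat.card {g // ρ.character g ≠ 0} =
      ∏ i, Nat.card {x // (σ i).character x ≠ 0} := by
    rw [← Nat.card_pi]
    refine Nat.card_congr ((Equiv.subtypeEquivRight fun g => ?_).trans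
      (Equiv.subtypePiEquivPi (p := fun i (x : P i) => (σ i).character x ≠ 0)))
    rw [hχ, Finset.prod_ne_zero_iff]
    simp
  rw [Finset.prod_ite_mem, Finset.univ_inter, Finset.prod_const, Finset.prod_pow,
    ← Nat.cast_prod, ← Nat.cast_prod, ← Nat.cast_prod, ← hN, ← hdeg, ← Nat.card_pi] at hmain
  refine le_trans ?_ hmain
  -- The primes `p i` need not be distinct, so only an inequality holds; it has the direction
  -- needed.
  have hωT : (Module.finrank ℂ V).primeFactors.card ≤ T.card := by
    refine le_trans (Finset.card_le_card fun q hq => ?_) (Finset.card_image_le (s := T) (f := p))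
    have hq' := Nat.prime_of_mem_primeFactors hq
    have hdvd := Nat.dvd_of_mem_primeFactors hq
    rw [hdeg, hq'.prime.dvd_finsetProd_iff] at hdvd
    obtain ⟨i, -, hi⟩ := hdvd
    obtain ⟨k, hk⟩ := hpow i
    have hqp : q = p i := by
      rw [hk] at hi
      exact (Nat.prime_dvd_prime_iff_eq hq' (hp i)).1 (hq'.dvd_of_dvd_pow hi)
    subst hqp
    exact Finset.mem_image_of_mem _ (by simp [T, hi])
  have h1 : (1 : ℝ) ≤ Nat.card {g // ρ.character g ≠ 0} := by
    rw [hN]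
    exact_mod_cast Finset.one_le_prod' fun i _ => hone i
  exact mul_le_mul_of_nonneg_right (pow_le_pow_right₀ (by norm_num) hωT) (by linarith)

/-! ### Nilpotent groups -/

theorem IsIrreducible.comp_mulEquiv {G H V : Type*} [Group G] [Group H] [AddCommGroup V]
    [Module ℂ V] {ρ : Representation ℂ G V} (hρ : ρ.IsIrreducible) (e : H ≃* G) :
    IsIrreducible (ρ.comp e.toMonoidHom : Representation ℂ H V) := by
  let f : Subrepresentation (ρ.comp e.toMonoidHom : Representation ℂ H V) ≃o
      Subrepresentation ρ :=
    { toFun S := ⟨S.toSubmodule, fun g v hv => by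
        simpa using S.apply_mem_toSubmodule (e.symm g) hv⟩
      invFun S := ⟨S.toSubmodule, fun h _ hv => S.apply_mem_toSubmodule (e h) hv⟩
      left_inv _ := rfl
      right_inv _ := rfl
      map_rel_iff' := Iff.rfl }
  exact f.isSimpleOrder

/-- The bound on the support of an irreducible character of a finite nilpotent group. -/
theorem IsIrreducible.two_pow_mul_card_support_le {G V : Type*} [Group G] [Finite G]
    [Group.IsNilpotent G] [AddCommGroup V] [Module ℂ V] [FiniteDimensional ℂ V]
    {ρ : Representation ℂ G V} (hρ : ρ.IsIrreducible) :
    2 ^ (Module.finrank ℂ V).primeFactors.card *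
        ((Nat.card {g // ρ.character g ≠ 0} : ℝ) - 1) ≤
      (Nat.card G : ℝ) - (Module.finrank ℂ V : ℝ) ^ 2 := by
  classical
  obtain ⟨e⟩ := (Group.isNilpotent_of_finite_tfae (G := G)).out 0 4 |>.1 ‹_›
  -- Indexing by pairs (prime, Sylow subgroup) avoids using uniqueness of Sylow subgroups, as the
  -- product bound allows repeated primes.
  let ι := Σ p : (Nat.card G).primeFactors, Sylow p G
  let e' : (∀ i : ι, (i.2 : Subgroup G)) ≃* G :=
    { toEquiv := (Equiv.piCurry fun (p : (Nat.card G).primeFactors) (S : Sylow p G) =>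
        (S : Subgroup G)).trans e.toEquiv
      map_mul' := fun x y => e.map_mul _ _ }
  have : Fintype ι := Fintype.ofFinite ι
  have h := (hρ.comp_mulEquiv e').two_pow_mul_card_support_le_pi
    (p := fun i : ι => (i.1 : ℕ)) (fun i => Nat.prime_of_mem_primeFactors i.1.2)
    (fun i => i.2.isPGroup')
  rw [Nat.card_congr e'.toEquiv] at h
  have hN : Nat.card {g // character
        (ρ.comp e'.toMonoidHom : Representation ℂ (∀ i : ι, (i.2 : Subgroup G)) V) g ≠ 0} =
      Nat.card {g // ρ.character g ≠ 0} :=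
    Nat.card_congr (e'.toEquiv.subtypeEquiv fun g => Iff.rfl)
  rwa [hN] at h

end Representation

theorem charOmega_eq_card_primeFactors {G : Type*} [Group G] {χ : G → ℂ} {d : ℕ} (hd : d ≠ 0)
    (h : χ 1 = d) : charOmega χ = d.primeFactors.card := by
  rw [charOmega, ← Set.ncard_coe_finset]
  congr 1
  ext p
  simp only [Set.mem_ofPred_eq, Finset.mem_coe, Nat.mem_primeFactors, h, Nat.cast_inj]
  constructor
  · rintro ⟨hp, _, rfl, hpd⟩
    exact ⟨hp, hpd, hd⟩
  · rintro ⟨hp, hpd, -⟩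
    exact ⟨hp, d, rfl, hpd⟩

theorem theorem9 {G : Type*} [Group G] [Finite G] [Group.IsNilpotent G] (χ : G → ℂ)
    (hχ : χ ∈ Irr G) :
    (Nat.card {g : G // χ g = 0} : ℝ) / (Nat.card G : ℝ) ≥
      1 - 1 / (2 : ℝ) ^ charOmega χ *
        (((Nat.card G : ℝ) - (χ 1).re ^ 2 + (2 : ℝ) ^ charOmega χ) / (Nat.card G : ℝ)) := by
  classical
  obtain ⟨n, ρ, hρ, rfl⟩ := hχ
  have hd : Module.finrank ℂ (Fin n → ℂ) ≠ 0 := by exact_mod_cast hρ.finrank_ne_zero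
  rw [charOmega_eq_card_primeFactors hd ρ.char_one, ρ.char_one, Complex.natCast_re]
  have h := hρ.two_pow_mul_card_support_le
  have hcard : (Nat.card {g // ρ.character g = 0} : ℝ) + Nat.card {g // ρ.character g ≠ 0} =
      Nat.card G := by
    rw [← Nat.cast_add, ← Nat.card_sum]
    exact_mod_cast Nat.card_congr (Equiv.sumCompl fun g => ρ.character g = 0)
  have hG : (0 : ℝ) < Nat.card G := by exact_mod_cast Nat.card_pos
  have h2 : (0 : ℝ) < 2 ^ (Module.finrank ℂ (Fin n → ℂ)).primeFactors.card := by positivity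
  generalize (2 : ℝ) ^ (Module.finrank ℂ (Fin n → ℂ)).primeFactors.card = t at *
  have h3 : (Nat.card {g // ρ.character g ≠ 0} : ℝ) ≤
      1 / t * ((Nat.card G : ℝ) - (Module.finrank ℂ (Fin n → ℂ) : ℝ) ^ 2 + t) := by
    rw [one_div, le_inv_mul_iff₀ h2]
    linarith
  rw [ge_iff_le, ← mul_div_assoc, one_sub_div hG.ne']
  gcongr
  linarith
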